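/- A permutation of size $n$ is viewed as a structure $(X, <_1, <_2)$ with $|X| = n$, where $<_1$ and $<_2$ are strict linear orders on $X$, in the first-order language with two binary relation symbols $<_1, <_2$. It is layered if $X$ can be partitioned into blocks, each of which is an interval of both $<_1$ and $<_2$, such that $<_1$ and $<_2$ disagree on any two distinct points of the same block and agree on any two points of different blocks (that is, it is an increasing sequence of decreasing blocks). Theorem. Layered permutations admit both a labeled and an unlabeled logical limit law. That is, for every first-order sentence $\varphi$ in the language $\{<_1, <_2\}$: (1) the probability that a uniformly random layered permutation with universe $\{1, \dots, n\}$ satisfies $\varphi$ converges to a limit as $n \to \infty$; (2) the probability that a uniformly random isomorphism type of layered permutations of size $n$ satisfies $\varphi$ converges to a limit as $n \to \infty$. -/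

import Mathlib

open Filter Topology CategoryTheory

namespace LimitLaw

section General

variable {L : FirstOrder.Language.{0, 0}}

/-- Isomorphism of `L`-structures with universe `Fin n`. -/
def isoSetoid (L : FirstOrder.Language.{0, 0}) (n : ℕ) : Setoid (L.Structure (Fin n)) :=
  (FirstOrder.Language.equivSetoid (L := L)).comap
    (fun S : L.Structure (Fin n) => (⟨Fin n, S⟩ : Bundled.{0} L.Structure))

/-- The structures in the class `C` with universe `Fin n`. -/
def structuresOn (C : Set (Bundled.{0} L.Structure)) (n : ℕ) : Set (L.Structure (Fin n)) :=
  {S | (⟨Fin n, S⟩ : Bundled.{0} L.Structure) ∈ C}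

/-- The structures with universe `Fin n` that satisfy the sentence `φ`. -/
def modelsOn (φ : L.Sentence) (n : ℕ) : Set (L.Structure (Fin n)) :=
  {S | @FirstOrder.Language.Sentence.Realize L (Fin n) S φ}

/-- The number of structures with universe `Fin n` in the set `A`. -/
noncomputable def labeledCount {n : ℕ} (A : Set (L.Structure (Fin n))) : ℕ :=
  A.ncard

/-- The number of isomorphism types of structures with universe `Fin n` in the set `A`. -/
noncomputable def unlabeledCount {n : ℕ} (A : Set (L.Structure (Fin n))) : ℕ :=
  (Quotient.mk (isoSetoid L n) '' A).ncard

/-- The class `C` admits a labeled logical limit law: for all large `n` there are finitely many,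
and at least one, structures in `C` on `n` points, and for every first-order sentence `φ` the
probability that a uniformly random one of them satisfies `φ` converges as `n → ∞`. -/
def LabeledLimitLaw (C : Set (Bundled.{0} L.Structure)) : Prop :=
  (∀ᶠ n in atTop, 0 < labeledCount (structuresOn C n)) ∧
    ∀ φ : L.Sentence, ∃ p : ℝ, Tendsto
      (fun n : ℕ => (labeledCount (structuresOn C n ∩ modelsOn φ n) : ℝ) /
        (labeledCount (structuresOn C n) : ℝ)) atTop (𝓝 p)

/-- The class `C` admits an unlabeled logical limit law: as above, with structures on `n` points
counted up to isomorphism. -/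
def UnlabeledLimitLaw (C : Set (Bundled.{0} L.Structure)) : Prop :=
  (∀ᶠ n in atTop, 0 < unlabeledCount (structuresOn C n)) ∧
    ∀ φ : L.Sentence, ∃ p : ℝ, Tendsto
      (fun n : ℕ => (unlabeledCount (structuresOn C n ∩ modelsOn φ n) : ℝ) /
        (unlabeledCount (structuresOn C n) : ℝ)) atTop (𝓝 p)

end General

/-- The relation symbols of the language of permutations: two binary symbols. -/
inductive PermRel : ℕ → Type
  | lt₁ : PermRel 2
  | lt₂ : PermRel 2

/-- The language of permutations, with the binary relation symbols `<₁` and `<₂`. -/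
def permLang : FirstOrder.Language.{0, 0} := ⟨fun _ => Empty, PermRel⟩

section Layered

variable {M : Type} [permLang.Structure M]

/-- The interpretation of `<₁`. -/
def Lt₁ (a b : M) : Prop :=
  FirstOrder.Language.Structure.RelMap (L := permLang) PermRel.lt₁ ![a, b]

/-- The interpretation of `<₂`. -/
def Lt₂ (a b : M) : Prop :=
  FirstOrder.Language.Structure.RelMap (L := permLang) PermRel.lt₂ ![a, b]

variable (M) in
/-- A finite permutation: a finite set with two strict linear orders. -/
structure IsPermutation : Prop where
  finite : Finite M
  lt₁ : IsStrictTotalOrder M Lt₁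
  lt₂ : IsStrictTotalOrder M Lt₂

variable (M) in
/-- A layered permutation: a permutation with a partition into blocks which are intervals of both
orders, such that the orders disagree inside each block (each block is decreasing) and agree
between points of different blocks (the sequence of blocks is increasing). -/
structure IsLayered : Prop extends IsPermutation M where
  exists_blocks : ∃ r : Setoid M,
    (∀ a b c : M, r a c → Lt₁ a b → Lt₁ b c → r a b) ∧
    (∀ a b c : M, r a c → Lt₂ a b → Lt₂ b c → r a b) ∧
    (∀ a b : M, r a b → Lt₁ a b → Lt₂ b a) ∧
    (∀ a b : M, ¬ r a b → Lt₁ a b → Lt₂ a b)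

end Layered

/-- The class of layered permutations. -/
def layeredPermutations : Set (Bundled.{0} permLang.Structure) :=
  {M | IsLayered M}

end LimitLaw

/-! A layered permutation of size `m + 1` is the same as a composition of `m + 1`. List the points
by `<₁` and write `true` at each point that starts a block. The first letter is forced, so the shape
is a word `c` of `m` free letters. A finite linear order is rigid, so a labeled structure is exactly
a pair of a labeling and a word `c`, and an isomorphism type is exactly a word `c`. Hence both
probabilities equal the fraction of words `c` for which `true :: c` satisfies `φ`.

By an Ehrenfeucht–Fraïssé argument, the truth of `φ` depends only on the splitting type of the word,
with one round beyond the quantifier rank of `φ`. There are finitely many types, types are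
compatible with concatenation (`splitType_append`), and long runs of `false` all have the same type
(`splitType_replicate`).

For a prefix of type `s`, let `g m s` be the fraction of extensions by `m` letters satisfying `φ`.
Then `g (m + 1) s` is the average of `g m` at the two successors of `s`, so convergence concerns a
finite Markov chain. Periodicity is excluded because enough letters `false` lead every state to a
fixed point of that letter (`IsAveraging.exists_tendsto`). -/

namespace LimitLaw

/-! ### Averaging iterations on a finite state space -/

section Averaging

variable {S : Type*} {a b : S → S}

/-- `g (n + 1)` is the average of `g n` along the two maps `a` and `b`. -/
def IsAveraging (a b : S → S) (g : ℕ → S → ℝ) : Prop :=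
  ∀ n s, g (n + 1) s = (g n (a s) + g n (b s)) / 2

theorem IsAveraging.sub {g h : ℕ → S → ℝ} (hg : IsAveraging a b g) (hh : IsAveraging a b h) :
    IsAveraging a b (fun n => g n - h n) := by
  intro n s
  simp only [Pi.sub_apply, hg n s, hh n s]
  ring

theorem IsAveraging.neg {g : ℕ → S → ℝ} (hg : IsAveraging a b g) :
    IsAveraging a b (fun n => -g n) := by
  intro n s
  simp only [Pi.neg_apply, hg n s]
  ring

theorem IsAveraging.shift {g : ℕ → S → ℝ} (hg : IsAveraging a b g) :
    IsAveraging a b (fun n => g (n + 1)) := fun n s => hg (n + 1) s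

theorem IsAveraging.norm_antitone [Fintype S] {g : ℕ → S → ℝ} (hg : IsAveraging a b g) :
    Antitone (fun n => ‖g n‖) := by
  refine antitone_nat_of_succ_le fun n => ?_
  refine (pi_norm_le_iff_of_nonneg (norm_nonneg _)).2 fun s => ?_
  have h1 := abs_le.1 (norm_le_pi_norm (g n) (a s))
  have h2 := abs_le.1 (norm_le_pi_norm (g n) (b s))
  rw [Real.norm_eq_abs, hg n s, abs_le]
  constructor <;> linarith [h1.1, h1.2, h2.1, h2.2]

/-- If an average of two numbers at most `M` is close to `M`, so is each of them. Each step back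
along `a` at most doubles the deficit. -/
theorem IsAveraging.deficit_le {d : ℕ → S → ℝ} (hd : IsAveraging a b d) {M : ℝ}
    (hM : ∀ n s, d n s ≤ M) (n i : ℕ) (s : S) :
    M - d n (a^[i] s) ≤ 2 ^ i * (M - d (n + i) s) := by
  induction i generalizing s with
  | zero => simp
  | succ i ih =>
    have h1 := ih (a s)
    have h2 : M - d (n + i) (a s) ≤ 2 * (M - d (n + (i + 1)) s) := by
      rw [← add_assoc, hd (n + i) s]
      linarith [hM (n + i) (b s)]
    rw [Function.iterate_succ_apply]
    calc _ ≤ _ := h1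
      _ ≤ 2 ^ i * (2 * (M - d (n + (i + 1)) s)) := by gcongr
      _ = _ := by ring

theorem iterate_eq_of_stable {K : ℕ} (ha : ∀ s, a^[K + 1] s = a^[K] s) (i : ℕ) (s : S) :
    a^[K + i] s = a^[K] s := by
  induction i with
  | zero => rfl
  | succ i ih =>
    rw [← add_assoc, Function.iterate_succ_apply', ih, ← Function.iterate_succ_apply' a, ha]

/-- An increment of size `L` at time `K + m` would force, along `a`, increments of at least `L / 2`
at all times `j < m`, all at the single state `a^[K] s`. Their sum telescopes to more than the range
`2 * C` allows. The slack `L / 2 / 2 ^ (K + m)` absorbs the doubling of the deficit. -/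
theorem IsAveraging.increment_lt {g : ℕ → S → ℝ} (hg : IsAveraging a b g) {K : ℕ}
    (ha : ∀ s, a^[K + 1] s = a^[K] s) {C L : ℝ} (hC : ∀ n s, |g n s| ≤ C) (hL : 0 < L)
    {m : ℕ} (hm : 2 * C < m * (L / 2))
    (hM : ∀ n s, g (n + 1) s - g n s ≤ L + L / 2 / 2 ^ (K + m)) (s : S) :
    g (K + m + 1) s - g (K + m) s < L := by
  by_contra! hs
  have hd : IsAveraging a b (fun n => g (n + 1) - g n) := hg.shift.sub hg
  have key : ∀ j ∈ Finset.range m, L / 2 ≤ g (j + 1) (a^[K] s) - g j (a^[K] s) := by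
    intro j hj
    have hj := Finset.mem_range.1 hj
    -- Going from time `K + m` back to time `j` takes `K + (m - j)` steps, enough to reach the fixed
    -- point of `a`.
    have h := hd.deficit_le (M := L + L / 2 / 2 ^ (K + m)) hM j (K + (m - j)) s
    have e : j + (K + (m - j)) = K + m := by omega
    rw [iterate_eq_of_stable ha, e] at h
    simp only [Pi.sub_apply] at h
    have hε : (0 : ℝ) < L / 2 / 2 ^ (K + m) := by positivity
    have h2 : (2 : ℝ) ^ (K + (m - j)) * (L + L / 2 / 2 ^ (K + m) -
        (g (K + m + 1) s - g (K + m) s)) ≤ 2 ^ (K + m) * (L / 2 / 2 ^ (K + m)) := by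
      apply mul_le_mul
      · exact pow_le_pow_right₀ (by norm_num) (by omega)
      · linarith
      · linarith [hM (K + m) s]
      · positivity
    have h3 : (2 : ℝ) ^ (K + m) * (L / 2 / 2 ^ (K + m)) = L / 2 := by field_simp
    linarith
  have hsum := Finset.card_nsmul_le_sum _ _ _ key
  rw [Finset.sum_range_sub (fun j => g j (a^[K] s)), Finset.card_range, nsmul_eq_mul] at hsum
  linarith [(abs_le.1 (hC m (a^[K] s))).2, (abs_le.1 (hC 0 (a^[K] s))).1]

theorem IsAveraging.tendsto_increment [Fintype S] {g : ℕ → S → ℝ} (hg : IsAveraging a b g) {K : ℕ}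
    (ha : ∀ s, a^[K + 1] s = a^[K] s) :
    Tendsto (fun n => ‖g (n + 1) - g n‖) atTop (𝓝 0) := by
  have hanti : Antitone (fun n => ‖g (n + 1) - g n‖) := (hg.shift.sub hg).norm_antitone
  have hbdd : BddBelow (Set.range fun n => ‖g (n + 1) - g n‖) :=
    ⟨0, by rintro _ ⟨n, rfl⟩; exact norm_nonneg _⟩
  have hlim := tendsto_atTop_ciInf hanti hbdd
  have hle : ∀ n, (⨅ n, ‖g (n + 1) - g n‖) ≤ ‖g (n + 1) - g n‖ := fun n => ciInf_le hbdd n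
  have hnn : 0 ≤ ⨅ n, ‖g (n + 1) - g n‖ := Real.iInf_nonneg fun n => norm_nonneg _
  generalize (⨅ n, ‖g (n + 1) - g n‖) = L at hlim hle hnn
  rcases hnn.eq_or_lt with rfl | hL
  · exact hlim
  exfalso
  obtain ⟨m, hm⟩ := exists_nat_gt (2 * ‖g 0‖ / (L / 2))
  rw [div_lt_iff₀ (by positivity)] at hm
  -- From time `n₀` on, all increments exceed their limiting norm `L` by less than the slack, so
  -- some increment norm falls below `L`, contradicting `hle`.
  obtain ⟨n₀, hn₀⟩ := (hlim.eventually_lt_const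
    (show L < L + L / 2 / 2 ^ (K + m) by simp; positivity)).exists
  have hC : ∀ n s, |g (n₀ + n) s| ≤ ‖g 0‖ := fun n s =>
    (norm_le_pi_norm (g (n₀ + n)) s).trans (hg.norm_antitone (Nat.zero_le _))
  have hM : ∀ n s, |g (n₀ + n + 1) s - g (n₀ + n) s| ≤ L + L / 2 / 2 ^ (K + m) := fun n s =>
    (norm_le_pi_norm (g (n₀ + n + 1) - g (n₀ + n)) s).trans
      ((hanti (Nat.le_add_right n₀ n)).trans hn₀.le)
  have hg' : IsAveraging a b (fun n => g (n₀ + n)) := fun n s => hg (n₀ + n) s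
  refine (hle (n₀ + (K + m))).not_gt ((pi_norm_lt_iff hL).2 fun s => ?_)
  rw [Real.norm_eq_abs, abs_lt, Pi.sub_apply]
  constructor
  · have := hg'.neg.increment_lt ha (C := ‖g 0‖) (L := L) (fun n s => by simpa using hC n s) hL hm
      (fun n s => by
        have := (abs_le.1 (hM n s)).1
        simp only [Pi.neg_apply, ← add_assoc]
        linarith) s
    simp only [Pi.neg_apply, ← add_assoc] at this ⊢
    linarith
  · exact hg'.increment_lt ha hC hL hm (fun n s => (abs_le.1 (hM n s)).2) s

/-- By compactness a subsequence converges to some `γ`. Vanishing increments make `γ` a fixed point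
of the averaging, so the distance from `g n` to `γ` is nonincreasing, and the whole sequence
converges. -/
theorem IsAveraging.exists_tendsto [Finite S] {g : ℕ → S → ℝ} (hg : IsAveraging a b g) {K : ℕ}
    (ha : ∀ s, a^[K + 1] s = a^[K] s) (s : S) :
    ∃ p, Tendsto (fun n => g n s) atTop (𝓝 p) := by
  have := Fintype.ofFinite S
  obtain ⟨γ, -, φ, hφ, hlim⟩ := tendsto_subseq_of_bounded
    (Metric.isBounded_closedBall (x := (0 : S → ℝ)) (r := ‖g 0‖)) (x := g)
    (fun n => by simpa using hg.norm_antitone (Nat.zero_le n))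
  have hpt : ∀ s, Tendsto (fun n => g (φ n) s) atTop (𝓝 (γ s)) := tendsto_pi_nhds.1 hlim
  have hinc : Tendsto (fun n => g (φ n + 1) - g (φ n)) atTop (𝓝 0) :=
    tendsto_zero_iff_norm_tendsto_zero.2 ((hg.tendsto_increment ha).comp hφ.tendsto_atTop)
  have hγ : IsAveraging a b (fun _ => γ) := by
    intro _ s
    have h1 : Tendsto (fun n => g (φ n + 1) s) atTop (𝓝 (γ s)) := by
      simpa using (tendsto_pi_nhds.1 hinc s).add (hpt s)
    have h2 : Tendsto (fun n => g (φ n + 1) s) atTop (𝓝 ((γ (a s) + γ (b s)) / 2)) := by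
      simp only [hg _ s]
      exact ((hpt _).add (hpt _)).div_const 2
    exact tendsto_nhds_unique h1 h2
  have h0 : Tendsto (fun n => ‖g n - γ‖) atTop (𝓝 0) := by
    refine (tendsto_iff_tendsto_subseq_of_antitone (hg.sub hγ).norm_antitone
      hφ.tendsto_atTop).2 ?_
    exact tendsto_iff_norm_sub_tendsto_zero.1 hlim
  exact ⟨γ s, tendsto_pi_nhds.1 (tendsto_iff_norm_sub_tendsto_zero.2 h0) s⟩

end Averaging

/-! ### Splitting types of binary words -/

/-- The type of `k`-round splitting types of binary words. -/
def SplitType : ℕ → Type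
  | 0 => Unit
  | k + 1 => SplitType k × Set (SplitType k × Bool × SplitType k)

instance finite_splitType : ∀ k, Finite (SplitType k)
  | 0 => inferInstanceAs (Finite Unit)
  | k + 1 =>
    have := finite_splitType k
    inferInstanceAs (Finite (SplitType k × Set (SplitType k × Bool × SplitType k)))

/-- The `k`-round splitting type of a word: it records the types of the two sides of every
letter. -/
def splitType : (k : ℕ) → List Bool → SplitType k
  | 0, _ => ()
  | k + 1, u =>
    (splitType k u, {t | ∃ x l y, u = x ++ l :: y ∧ t = (splitType k x, l, splitType k y)})

theorem splitType_succ_eq_iff {k : ℕ} {u v : List Bool} :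
    splitType (k + 1) u = splitType (k + 1) v ↔ splitType k u = splitType k v ∧
      (∀ x l y, u = x ++ l :: y → ∃ x' y', v = x' ++ l :: y' ∧
        splitType k x = splitType k x' ∧ splitType k y = splitType k y') ∧
      (∀ x l y, v = x ++ l :: y → ∃ x' y', u = x' ++ l :: y' ∧
        splitType k x = splitType k x' ∧ splitType k y = splitType k y') := by
  refine (Prod.ext_iff (α := SplitType k)
    (β := Set (SplitType k × Bool × SplitType k))).trans (and_congr_right fun _ => ?_)
  change {t | ∃ x l y, u = x ++ l :: y ∧ t = (splitType k x, l, splitType k y)} =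
    {t | ∃ x l y, v = x ++ l :: y ∧ t = (splitType k x, l, splitType k y)} ↔ _
  rw [Set.Subset.antisymm_iff]
  refine and_congr ?_ ?_
  all_goals
    constructor
    · intro h x l y hx
      obtain ⟨x', l', y', h1, h2⟩ := h ⟨x, l, y, hx, rfl⟩
      simp only [Prod.mk.injEq] at h2
      obtain ⟨h2, rfl, h3⟩ := h2
      exact ⟨x', y', h1, h2, h3⟩
    · rintro h _ ⟨x, l, y, hx, rfl⟩
      obtain ⟨x', y', h1, h2, h3⟩ := h x l y hx
      exact ⟨x', l, y', h1, by rw [h2, h3]⟩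

theorem append_eq_append_cons {u v x y : List Bool} {l : Bool} (h : u ++ v = x ++ l :: y) :
    (∃ z, u = x ++ l :: z ∧ y = z ++ v) ∨ ∃ z, x = u ++ z ∧ v = z ++ l :: y := by
  rcases List.append_eq_append_iff.1 h with ⟨z, h1, h2⟩ | ⟨z, h1, h2⟩
  · exact Or.inr ⟨z, h1, h2⟩
  · cases z with
    | nil => exact Or.inr ⟨[], by simpa using h1.symm, by simpa using h2.symm⟩
    | cons c z =>
      simp only [List.cons_append, List.cons.injEq] at h2
      obtain ⟨rfl, rfl⟩ := h2
      exact Or.inl ⟨z, h1, rfl⟩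

/-- A letter of `u ++ v` splits only one of the two factors; the other one stays whole and is
absorbed by induction. -/
theorem splitType_append {k : ℕ} {u u' v v' : List Bool} (hu : splitType k u = splitType k u')
    (hv : splitType k v = splitType k v') : splitType k (u ++ v) = splitType k (u' ++ v') := by
  induction k generalizing u u' v v' with
  | zero => rfl
  | succ k ih =>
    have forth : ∀ {u u' v v' : List Bool}, splitType (k + 1) u = splitType (k + 1) u' →
        splitType (k + 1) v = splitType (k + 1) v' → ∀ x l y, u ++ v = x ++ l :: y →
        ∃ x' y', u' ++ v' = x' ++ l :: y' ∧
          splitType k x = splitType k x' ∧ splitType k y = splitType k y' := by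
      intro u u' v v' hu hv x l y h
      obtain ⟨hu1, hu2, -⟩ := splitType_succ_eq_iff.1 hu
      obtain ⟨hv1, hv2, -⟩ := splitType_succ_eq_iff.1 hv
      rcases append_eq_append_cons h with ⟨z, rfl, rfl⟩ | ⟨z, rfl, rfl⟩
      · obtain ⟨x', z', rfl, h1, h2⟩ := hu2 x l z rfl
        exact ⟨x', z' ++ v', by simp, h1, ih h2 hv1⟩
      · obtain ⟨z', y', rfl, h1, h2⟩ := hv2 z l y rfl
        exact ⟨u' ++ z', y', by simp, ih hu1 h1, h2⟩
    exact splitType_succ_eq_iff.2 ⟨ih (splitType_succ_eq_iff.1 hu).1 (splitType_succ_eq_iff.1 hv).1,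
      forth hu hv, forth hu.symm hv.symm⟩

theorem replicate_eq_append_cons {p : ℕ} {x y : List Bool} {c l : Bool}
    (h : List.replicate p c = x ++ l :: y) : l = c ∧ x = List.replicate x.length c ∧
      y = List.replicate y.length c ∧ p = x.length + y.length + 1 := by
  have hlen := congrArg List.length h
  have hmem : ∀ z ∈ x ++ l :: y, z = c := fun z hz => List.eq_of_mem_replicate (h ▸ hz)
  refine ⟨hmem l (by simp), List.eq_replicate_iff.2 ⟨rfl, fun z hz => hmem z (by simp [hz])⟩,
    List.eq_replicate_iff.2 ⟨rfl, fun z hz => hmem z (by simp [hz])⟩, ?_⟩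
  simp at hlen
  omega

/-- Removing a letter leaves lengths `i` and `j` with `p + 1 = (i + 1) + (j + 1)`, so at least one
side meets the threshold for `k`. -/
theorem splitType_replicate (k : ℕ) {p q : ℕ} (c : Bool) (hp : 2 ^ k ≤ p + 1) (hq : 2 ^ k ≤ q + 1) :
    splitType k (List.replicate p c) = splitType k (List.replicate q c) := by
  induction k generalizing p q with
  | zero => rfl
  | succ k ih =>
    have forth : ∀ {p q : ℕ}, 2 ^ (k + 1) ≤ p + 1 → 2 ^ (k + 1) ≤ q + 1 → ∀ x l y,
        List.replicate p c = x ++ l :: y → ∃ x' y', List.replicate q c = x' ++ l :: y' ∧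
          splitType k x = splitType k x' ∧ splitType k y = splitType k y' := by
      intro p q hp hq x l y h
      obtain ⟨rfl, hx, hy, hlen⟩ := replicate_eq_append_cons h
      -- A short side is copied exactly and the other side takes the rest. If both sides are long,
      -- any two long sides will do.
      have main : ∃ i j, q = i + (j + 1) ∧
          (i = x.length ∨ 2 ^ k ≤ i + 1 ∧ 2 ^ k ≤ x.length + 1) ∧
          (j = y.length ∨ 2 ^ k ≤ j + 1 ∧ 2 ^ k ≤ y.length + 1) := by
        rw [pow_succ] at hp hq
        by_cases h1 : x.length + 1 < 2 ^ k
        · exact ⟨x.length, q - x.length - 1, by omega, by omega, by omega⟩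
        · by_cases h2 : y.length + 1 < 2 ^ k
          · exact ⟨q - y.length - 1, y.length, by omega, by omega, by omega⟩
          · have := Nat.one_le_two_pow (n := k)
            exact ⟨2 ^ k - 1, q - 2 ^ k, by omega, by omega, by omega⟩
      obtain ⟨i, j, rfl, hi, hj⟩ := main
      refine ⟨List.replicate i l, List.replicate j l, ?_, ?_, ?_⟩
      · rw [List.replicate_add, List.replicate_succ]
      · rw [hx]
        rcases hi with rfl | ⟨h1, h2⟩
        · rfl
        · exact ih h2 h1
      · rw [hy]
        rcases hj with rfl | ⟨h1, h2⟩
        · rfl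
        · exact ih h2 h1
    have := Nat.pow_le_pow_right (n := 2) (by norm_num) (Nat.le_succ k)
    exact splitType_succ_eq_iff.2 ⟨ih (by omega) (by omega), forth hp hq, forth hq hp⟩

/-! ### Ehrenfeucht–Fraïssé games on words -/

/-- A set of pairs of positions in two words that preserves letters and the order. -/
def IsMatching (u v : List Bool) (P : Set (ℕ × ℕ)) : Prop :=
  (∀ p ∈ P, p.1 < u.length ∧ p.2 < v.length ∧ u[p.1]? = v[p.2]?) ∧
    ∀ p ∈ P, ∀ q ∈ P, (p.1 < q.1 ↔ p.2 < q.2)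

/-- The second player survives `k` rounds of the Ehrenfeucht–Fraïssé game on the words `u` and `v`
from the position `P`. -/
def BackForth (u v : List Bool) : ℕ → Set (ℕ × ℕ) → Prop
  | 0, P => IsMatching u v P
  | k + 1, P => IsMatching u v P ∧
      (∀ i < u.length, ∃ j < v.length, BackForth u v k (insert (i, j) P)) ∧
      (∀ j < v.length, ∃ i < u.length, BackForth u v k (insert (i, j) P))

theorem BackForth.isMatching {u v : List Bool} {k : ℕ} {P : Set (ℕ × ℕ)}
    (h : BackForth u v k P) : IsMatching u v P := by
  cases k with
  | zero => exact h
  | succ k => exact h.1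

theorem BackForth.of_succ {u v : List Bool} {k : ℕ} {P : Set (ℕ × ℕ)}
    (h : BackForth u v (k + 1) P) : BackForth u v k P := by
  induction k generalizing P with
  | zero => exact h.isMatching
  | succ k ih =>
    refine ⟨h.1, fun i hi => ?_, fun j hj => ?_⟩
    · obtain ⟨j, hj, h'⟩ := h.2.1 i hi
      exact ⟨j, hj, ih h'⟩
    · obtain ⟨i, hi, h'⟩ := h.2.2 j hj
      exact ⟨i, hi, ih h'⟩

theorem backForth_refl (u : List Bool) (k : ℕ) {P : Set (ℕ × ℕ)}
    (hP : ∀ p ∈ P, p.1 = p.2 ∧ p.1 < u.length) : BackForth u u k P := by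
  have hm : IsMatching u u P := by
    refine ⟨fun p hp => ?_, fun p hp q hq => ?_⟩
    · obtain ⟨h1, h2⟩ := hP p hp
      exact ⟨h2, h1 ▸ h2, by rw [h1]⟩
    · rw [(hP p hp).1, (hP q hq).1]
  induction k generalizing P with
  | zero => exact hm
  | succ k ih =>
    have hins : ∀ i < u.length, BackForth u u k (insert (i, i) P) := fun i hi => by
      have hP' : ∀ p ∈ insert (i, i) P, p.1 = p.2 ∧ p.1 < u.length := by
        rintro p (rfl | hp)
        · exact ⟨rfl, hi⟩
        · exact hP p hp
      refine ih hP' ⟨fun p hp => ?_, fun p hp q hq => ?_⟩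
      · obtain ⟨h1, h2⟩ := hP' p hp
        exact ⟨h2, h1 ▸ h2, by rw [h1]⟩
      · rw [(hP' p hp).1, (hP' q hq).1]
    exact ⟨hm, fun i hi => ⟨i, hi, hins i hi⟩, fun i hi => ⟨i, hi, hins i hi⟩⟩

/-- The union of two positions, the second one shifted by `(m, n)`. -/
def shiftUnion (m n : ℕ) (P Q : Set (ℕ × ℕ)) : Set (ℕ × ℕ) :=
  P ∪ (fun q => (m + q.1, n + q.2)) '' Q

theorem insert_shiftUnion (m n : ℕ) (P Q : Set (ℕ × ℕ)) (p : ℕ × ℕ) :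
    insert p (shiftUnion m n P Q) = shiftUnion m n (insert p P) Q :=
  (Set.insert_union ..).symm

theorem insert_add_shiftUnion (m n : ℕ) (P Q : Set (ℕ × ℕ)) (i j : ℕ) :
    insert (m + i, n + j) (shiftUnion m n P Q) = shiftUnion m n P (insert (i, j) Q) := by
  rw [shiftUnion, shiftUnion, Set.image_insert_eq, Set.union_insert]

theorem IsMatching.append {u u' v v' : List Bool} {P Q : Set (ℕ × ℕ)} (hP : IsMatching u u' P)
    (hQ : IsMatching v v' Q) :
    IsMatching (u ++ v) (u' ++ v') (shiftUnion u.length u'.length P Q) := by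
  refine ⟨?_, ?_⟩
  · rintro p (hp | ⟨q, hq, rfl⟩)
    · obtain ⟨h1, h2, h3⟩ := hP.1 p hp
      refine ⟨by simp; omega, by simp; omega, ?_⟩
      rw [List.getElem?_append_left h1, List.getElem?_append_left h2, h3]
    · obtain ⟨h1, h2, h3⟩ := hQ.1 q hq
      refine ⟨by simp; omega, by simp; omega, ?_⟩
      rw [List.getElem?_append_right (by simp), List.getElem?_append_right (by simp)]
      simpa using h3
  · rintro p (hp | ⟨p, hp, rfl⟩) q (hq | ⟨q, hq, rfl⟩)
    · exact hP.2 p hp q hq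
    · have := hP.1 p hp
      simp only
      omega
    · have := hP.1 q hq
      simp only
      omega
    · have := hQ.2 p hp q hq
      simp only
      omega

/-- Each move is answered in the factor where it was made; the other factor forgoes a round. -/
theorem BackForth.append {u u' v v' : List Bool} {k : ℕ} {P Q : Set (ℕ × ℕ)}
    (hP : BackForth u u' k P) (hQ : BackForth v v' k Q) :
    BackForth (u ++ v) (u' ++ v') k (shiftUnion u.length u'.length P Q) := by
  induction k generalizing P Q with
  | zero => exact IsMatching.append hP hQ
  | succ k ih =>
    refine ⟨hP.isMatching.append hQ.isMatching, fun i hi => ?_, fun j hj => ?_⟩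
    · rcases lt_or_ge i u.length with h | h
      · obtain ⟨j, hj, h'⟩ := hP.2.1 i h
        refine ⟨j, by simp; omega, ?_⟩
        rw [insert_shiftUnion]
        exact ih h' hQ.of_succ
      · obtain ⟨i, rfl⟩ := Nat.exists_eq_add_of_le h
        obtain ⟨j, hj, h'⟩ := hQ.2.1 i (by simpa using hi)
        refine ⟨u'.length + j, by simpa using hj, ?_⟩
        rw [insert_add_shiftUnion]
        exact ih hP.of_succ h'
    · rcases lt_or_ge j u'.length with h | h
      · obtain ⟨i, hi, h'⟩ := hP.2.2 j h
        refine ⟨i, by simp; omega, ?_⟩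
        rw [insert_shiftUnion]
        exact ih h' hQ.of_succ
      · obtain ⟨j, rfl⟩ := Nat.exists_eq_add_of_le h
        obtain ⟨i, hi, h'⟩ := hQ.2.2 j (by simpa using hj)
        refine ⟨u.length + i, by simpa using hi, ?_⟩
        rw [insert_add_shiftUnion]
        exact ih hP.of_succ h'

theorem eq_append_cons_of_lt {u : List Bool} {i : ℕ} (hi : i < u.length) :
    ∃ x l y, u = x ++ l :: y ∧ x.length = i :=
  ⟨u.take i, u[i], u.drop (i + 1), by simp, by simp; omega⟩

/-- After the first move the game decomposes into the left sides, the chosen letter and the right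
sides, whose strategies are glued by `BackForth.append`. -/
theorem backForth_of_splitType_eq {k : ℕ} {u v : List Bool} (h : splitType k u = splitType k v) :
    BackForth u v k ∅ := by
  have hm : ∀ u v, IsMatching u v ∅ := fun u v => ⟨by simp, by simp⟩
  induction k generalizing u v with
  | zero => exact hm u v
  | succ k ih =>
    have key : ∀ {x y x' y' : List Bool} (l : Bool), splitType k x = splitType k x' →
        splitType k y = splitType k y' →
        BackForth (x ++ l :: y) (x' ++ l :: y') k (insert (x.length, x'.length) ∅) := by
      intro x y x' y' l hx hy
      have h1 : BackForth [l] [l] k {(0, 0)} := backForth_refl [l] k (by simp)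
      convert (ih hx).append (h1.append (ih hy)) using 1
      all_goals simp [shiftUnion]
    obtain ⟨-, h2, h3⟩ := splitType_succ_eq_iff.1 h
    refine ⟨hm u v, fun i hi => ?_, fun j hj => ?_⟩
    · obtain ⟨x, l, y, rfl, rfl⟩ := eq_append_cons_of_lt hi
      obtain ⟨x', y', rfl, hx, hy⟩ := h2 x l y rfl
      exact ⟨x'.length, by simp, key l hx hy⟩
    · obtain ⟨x, l, y, rfl, rfl⟩ := eq_append_cons_of_lt hj
      obtain ⟨x', y', rfl, hx, hy⟩ := h3 x l y rfl
      exact ⟨x'.length, by simp, key l hx.symm hy.symm⟩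

/-! ### From games to first-order sentences -/

open FirstOrder FirstOrder.Language

/-- The quantifier rank of a formula. -/
def quantifierRank {L : FirstOrder.Language.{0, 0}} {α : Type} :
    ∀ {n : ℕ}, L.BoundedFormula α n → ℕ
  | _, .falsum => 0
  | _, .equal _ _ => 0
  | _, .rel _ _ => 0
  | _, .imp f g => max (quantifierRank f) (quantifierRank g)
  | _, .all f => quantifierRank f + 1

theorem range_snoc_pair {M N : Type*} {n : ℕ} (x : Fin n → M) (y : Fin n → N) (a : M) (b : N) :
    Set.range (fun i => ((Fin.snoc x a : Fin (n + 1) → M) i, (Fin.snoc y b : Fin (n + 1) → N) i)) =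
      insert (a, b) (Set.range fun i => (x i, y i)) := by
  ext p
  simp only [Set.mem_range, Set.mem_insert_iff]
  constructor
  · rintro ⟨i, rfl⟩
    induction i using Fin.lastCases with
    | last => left; simp
    | cast i => right; exact ⟨i, by simp⟩
  · rintro (rfl | ⟨i, rfl⟩)
    · exact ⟨Fin.last n, by simp⟩
    · exact ⟨i.castSucc, by simp⟩

section Transfer

variable {M N : Type} [permLang.Structure M] [permLang.Structure N]

theorem relMap_lt₁ (x : Fin 2 → M) :
    Structure.RelMap (L := permLang) PermRel.lt₁ x ↔ Lt₁ (x 0) (x 1) := by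
  have e : x = ![x 0, x 1] := by
    ext i
    fin_cases i <;> rfl
  exact iff_of_eq (congrArg (Structure.RelMap (L := permLang) PermRel.lt₁) e)

theorem relMap_lt₂ (x : Fin 2 → M) :
    Structure.RelMap (L := permLang) PermRel.lt₂ x ↔ Lt₂ (x 0) (x 1) := by
  have e : x = ![x 0, x 1] := by
    ext i
    fin_cases i <;> rfl
  exact iff_of_eq (congrArg (Structure.RelMap (L := permLang) PermRel.lt₂) e)

theorem exists_var {n : ℕ} (t : permLang.Term (Empty ⊕ Fin n)) : ∃ i, t = .var (.inr i) := by
  rcases t with (e | i) | ⟨f, _⟩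
  · exact e.elim
  · exact ⟨i, rfl⟩
  · exact Empty.elim f

/-- Induction on the formula: each quantifier costs one round. The language has no function symbols,
so terms are variables and atomic formulas only see the chosen pairs. -/
theorem realize_iff_of_backAndForth {E : ℕ → Set (M × N) → Prop}
    (hsucc : ∀ k P, E (k + 1) P → E k P)
    (heq : ∀ P, E 0 P → ∀ p ∈ P, ∀ q ∈ P, (p.1 = q.1 ↔ p.2 = q.2))
    (h₁ : ∀ P, E 0 P → ∀ p ∈ P, ∀ q ∈ P, (Lt₁ p.1 q.1 ↔ Lt₁ p.2 q.2))
    (h₂ : ∀ P, E 0 P → ∀ p ∈ P, ∀ q ∈ P, (Lt₂ p.1 q.1 ↔ Lt₂ p.2 q.2))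
    (hforth : ∀ k P, E (k + 1) P → ∀ a, ∃ b, E k (insert (a, b) P))
    (hback : ∀ k P, E (k + 1) P → ∀ b, ∃ a, E k (insert (a, b) P))
    {n : ℕ} (φ : permLang.BoundedFormula Empty n) {v : Empty → M} {w : Empty → N}
    {x : Fin n → M} {y : Fin n → N} {k : ℕ} (hk : quantifierRank φ ≤ k)
    (hE : E k (Set.range fun i => (x i, y i))) : φ.Realize v x ↔ φ.Realize w y := by
  have hzero : ∀ k P, E k P → E 0 P := by
    intro k P
    induction k with
    | zero => exact id
    | succ k ih => exact fun h => ih (hsucc k P h)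
  induction φ generalizing k with
  | falsum => rfl
  | equal t₁ t₂ =>
    obtain ⟨i, rfl⟩ := exists_var t₁
    obtain ⟨j, rfl⟩ := exists_var t₂
    exact heq _ (hzero _ _ hE) _ ⟨i, rfl⟩ _ ⟨j, rfl⟩
  | rel R ts =>
    choose f hf using fun i => exists_var (ts i)
    obtain rfl : ts = fun i => .var (.inr (f i)) := funext hf
    cases R with
    | lt₁ =>
      refine (relMap_lt₁ _).trans (Iff.trans ?_ (relMap_lt₁ _).symm)
      exact h₁ _ (hzero _ _ hE) _ ⟨f 0, rfl⟩ _ ⟨f 1, rfl⟩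
    | lt₂ =>
      refine (relMap_lt₂ _).trans (Iff.trans ?_ (relMap_lt₂ _).symm)
      exact h₂ _ (hzero _ _ hE) _ ⟨f 0, rfl⟩ _ ⟨f 1, rfl⟩
  | imp f g ihf ihg =>
    have hk' := max_le_iff.1 hk
    exact imp_congr (ihf hk'.1 hE) (ihg hk'.2 hE)
  | all f ih =>
    obtain ⟨k, rfl⟩ := Nat.exists_eq_add_one_of_ne_zero (n := k) (by
      have : quantifierRank f + 1 ≤ k := hk
      omega)
    have hk' : quantifierRank f ≤ k := Nat.le_of_succ_le_succ hk
    constructor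
    · intro h b
      obtain ⟨a, hab⟩ := hback k _ hE b
      exact (ih hk' (by rwa [range_snoc_pair])).1 (h a)
    · intro h a
      obtain ⟨b, hab⟩ := hforth k _ hE a
      exact (ih hk' (by rwa [range_snoc_pair])).2 (h b)

end Transfer

/-! ### Layered permutations given by words -/

/-- Some letter of `u` at a position in `(i, j]` is `true`. -/
def Separated (u : List Bool) (i j : ℕ) : Prop :=
  ∃ k, i < k ∧ k ≤ j ∧ u[k]? = some true

/-- The second order of the layered permutation whose blocks start at the letters `true`. -/
def LayeredLt (u : List Bool) (i j : ℕ) : Prop :=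
  (i < j ∧ Separated u i j) ∨ (j < i ∧ ¬ Separated u j i)

/-- The layered permutation with blocks given by the word `u`, with its points labeled by `σ`. -/
@[reducible] def layeredStructure (u : List Bool) {n : ℕ} (σ : Equiv.Perm (Fin n)) :
    permLang.Structure (Fin n) where
  funMap := fun f => Empty.elim f
  RelMap := fun R => match R with
    | PermRel.lt₁ => fun x => σ (x 0) < σ (x 1)
    | PermRel.lt₂ => fun x => LayeredLt u (σ (x 0)) (σ (x 1))

theorem layeredStructure_lt₁ (u : List Bool) {n : ℕ} (σ : Equiv.Perm (Fin n)) (a b : Fin n) :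
    letI := layeredStructure u σ
    Lt₁ a b ↔ σ a < σ b := Iff.rfl

theorem layeredStructure_lt₂ (u : List Bool) {n : ℕ} (σ : Equiv.Perm (Fin n)) (a b : Fin n) :
    letI := layeredStructure u σ
    Lt₂ a b ↔ LayeredLt u (σ a) (σ b) := Iff.rfl

/-- The spare round is spent on choosing the separating letter. This is why `<₂` needs one round
more than the quantifier rank. -/
theorem BackForth.separated_of_lt {u v : List Bool} {k : ℕ} {P : Set (ℕ × ℕ)}
    (h : BackForth u v (k + 1) P) {p q : ℕ × ℕ} (hp : p ∈ P) (hq : q ∈ P) :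
    Separated u p.1 q.1 ↔ Separated v p.2 q.2 := by
  constructor
  · rintro ⟨i, h1, h2, h3⟩
    obtain ⟨hi, -⟩ := List.getElem?_eq_some_iff.1 h3
    obtain ⟨j, -, hj⟩ := h.2.1 i hi
    have hm := hj.isMatching
    have e1 := hm.2 p (.inr hp) _ (.inl rfl)
    have e2 := hm.2 q (.inr hq) _ (.inl rfl)
    exact ⟨j, e1.1 h1, by simp only at e2; omega, (hm.1 _ (.inl rfl)).2.2.symm.trans h3⟩
  · rintro ⟨j, h1, h2, h3⟩
    obtain ⟨hj, -⟩ := List.getElem?_eq_some_iff.1 h3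
    obtain ⟨i, -, hi⟩ := h.2.2 j hj
    have hm := hi.isMatching
    have e1 := hm.2 p (.inr hp) _ (.inl rfl)
    have e2 := hm.2 q (.inr hq) _ (.inl rfl)
    exact ⟨i, e1.2 h1, by simp only at e2; omega, (hm.1 _ (.inl rfl)).2.2.trans h3⟩

/-- The sentence `φ` holds in the layered permutation given by the word `u`. -/
def WordRealize (φ : permLang.Sentence) (u : List Bool) : Prop :=
  @Sentence.Realize permLang (Fin u.length) (layeredStructure u 1) φ

theorem wordRealize_iff_of_backForth (φ : permLang.Sentence) {u v : List Bool}
    (h : BackForth u v (quantifierRank φ + 1) ∅) : WordRealize φ u ↔ WordRealize φ v := by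
  let _ : permLang.Structure (Fin u.length) := layeredStructure u 1
  let _ : permLang.Structure (Fin v.length) := layeredStructure v 1
  let π : Fin u.length × Fin v.length → ℕ × ℕ := fun p => (p.1, p.2)
  refine realize_iff_of_backAndForth (M := Fin u.length) (N := Fin v.length)
    (E := fun k P => BackForth u v (k + 1) (π '' P))
    (fun k P h => h.of_succ) ?_ ?_ ?_ ?_ ?_ φ le_rfl (by simpa using h)
  · intro P h p hp q hq
    have e1 := h.isMatching.2 _ (Set.mem_image_of_mem π hp) _ (Set.mem_image_of_mem π hq)
    have e2 := h.isMatching.2 _ (Set.mem_image_of_mem π hq) _ (Set.mem_image_of_mem π hp)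
    simp only [π] at e1 e2
    omega
  · intro P h p hp q hq
    exact h.isMatching.2 _ (Set.mem_image_of_mem π hp) _ (Set.mem_image_of_mem π hq)
  · intro P h p hp q hq
    have hp' := Set.mem_image_of_mem π hp
    have hq' := Set.mem_image_of_mem π hq
    exact or_congr (and_congr (h.isMatching.2 _ hp' _ hq') (h.separated_of_lt hp' hq'))
      (and_congr (h.isMatching.2 _ hq' _ hp') (not_congr (h.separated_of_lt hq' hp')))
  · intro k P h a
    obtain ⟨j, hj, h'⟩ := h.2.1 a a.2
    exact ⟨⟨j, hj⟩, by rwa [Set.image_insert_eq]⟩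
  · intro k P h b
    obtain ⟨i, hi, h'⟩ := h.2.2 b b.2
    exact ⟨⟨i, hi⟩, by rwa [Set.image_insert_eq]⟩

theorem wordRealize_iff_of_splitType_eq (φ : permLang.Sentence) {u v : List Bool}
    (h : splitType (quantifierRank φ + 1) u = splitType (quantifierRank φ + 1) v) :
    WordRealize φ u ↔ WordRealize φ v :=
  wordRealize_iff_of_backForth φ (backForth_of_splitType_eq h)

/-! ### Density of words with a recognizable property -/

/-- The number of words of length `m` with the property `p`. -/
noncomputable def wordCount (p : List Bool → Prop) (m : ℕ) : ℕ :=
  {c : Fin m → Bool | p (List.ofFn c)}.ncard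

theorem wordCount_true (m : ℕ) : wordCount (fun _ => True) m = 2 ^ m := by
  simp [wordCount, Set.ncard_univ]

theorem wordCount_succ (p : List Bool → Prop) (m : ℕ) :
    wordCount p (m + 1) =
      wordCount (fun l => p (false :: l)) m + wordCount (fun l => p (true :: l)) m := by
  have hinj : ∀ x : Bool, Function.Injective
      (fun c : Fin m → Bool => (Fin.cons x c : Fin (m + 1) → Bool)) :=
    fun x => Fin.cons_right_injective (α := fun _ => Bool) x
  have e : {c : Fin (m + 1) → Bool | p (List.ofFn c)} =
      (fun c : Fin m → Bool => (Fin.cons false c : Fin (m + 1) → Bool)) ''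
        {c | p (false :: List.ofFn c)} ∪
      (fun c : Fin m → Bool => (Fin.cons true c : Fin (m + 1) → Bool)) ''
        {c | p (true :: List.ofFn c)} := by
    ext c
    induction c using Fin.consCases with
    | _ x c => cases x <;> simp [Fin.cons_inj]
  rw [wordCount, e, Set.ncard_union_eq, Set.ncard_image_of_injective _ (hinj _),
    Set.ncard_image_of_injective _ (hinj _)]
  · rfl
  · rw [Set.disjoint_left]
    rintro _ ⟨c, -, rfl⟩ ⟨d, -, h⟩
    simpa using congrFun h 0

/-- The words modulo `τ` are the states of a finite automaton reading letters on the right.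
Splitting on the next letter makes the densities an averaging sequence, and `hK` is its stability
under `false`. -/
theorem exists_tendsto_wordCount {F : Type*} [Finite F] (τ : List Bool → F) {K : ℕ}
    (hτ : ∀ u v l, τ u = τ v → τ (u ++ l) = τ (v ++ l))
    (hK : ∀ u, τ (u ++ List.replicate (K + 1) false) = τ (u ++ List.replicate K false))
    {p : List Bool → Prop} (hp : ∀ u v, τ u = τ v → (p u ↔ p v)) (u : List Bool) :
    ∃ r : ℝ, Tendsto (fun m => (wordCount (fun l => p (u ++ l)) m : ℝ) / 2 ^ m) atTop (𝓝 r) := by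
  have : Finite (Quotient (Setoid.ker τ)) := Finite.of_injective _ (Setoid.kerLift_injective τ)
  let step (x : Bool) : Quotient (Setoid.ker τ) → Quotient (Setoid.ker τ) :=
    Quotient.map (· ++ [x]) fun u v h => hτ u v _ h
  let g (m : ℕ) : Quotient (Setoid.ker τ) → ℝ :=
    Quotient.lift (fun u => (wordCount (fun l => p (u ++ l)) m : ℝ) / 2 ^ m) fun u v h => by
      have : (fun l => p (u ++ l)) = fun l => p (v ++ l) :=
        funext fun l => propext (hp _ _ (hτ u v l h))
      simp only [this]
  have hg : IsAveraging (step false) (step true) g := by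
    rintro m ⟨u⟩
    change (wordCount (fun l => p (u ++ l)) (m + 1) : ℝ) / 2 ^ (m + 1) =
      ((wordCount (fun l => p (u ++ [false] ++ l)) m : ℝ) / 2 ^ m +
        (wordCount (fun l => p (u ++ [true] ++ l)) m : ℝ) / 2 ^ m) / 2
    simp only [wordCount_succ, List.append_assoc, List.singleton_append, Nat.cast_add, pow_succ]
    field_simp
  have hiter : ∀ (i : ℕ) (u : List Bool), (step false)^[i] (Quotient.mk _ u) =
      Quotient.mk _ (u ++ List.replicate i false) := by
    intro i
    induction i with
    | zero => simp
    | succ i ih =>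
      intro u
      rw [Function.iterate_succ_apply]
      refine (ih (u ++ [false])).trans ?_
      simp [List.replicate_succ]
  refine hg.exists_tendsto (K := K) ?_ (Quotient.mk _ u)
  rintro ⟨u⟩
  exact (hiter _ u).trans ((Quotient.sound (hK u)).trans (hiter _ u).symm)

theorem exists_tendsto_wordRealize (φ : permLang.Sentence) (u : List Bool) :
    ∃ r : ℝ, Tendsto (fun m => (wordCount (fun l => WordRealize φ (u ++ l)) m : ℝ) / 2 ^ m)
      atTop (𝓝 r) :=
  exists_tendsto_wordCount (splitType (quantifierRank φ + 1)) (K := 2 ^ (quantifierRank φ + 1))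
    (fun _ _ _ h => splitType_append h rfl)
    (fun _ => splitType_append rfl (splitType_replicate _ _ (by omega) (by omega)))
    (fun _ _ => wordRealize_iff_of_splitType_eq φ) u

/-! ### Words define layered permutations -/

theorem separated_iff_or {u : List Bool} {i j k : ℕ} (hij : i ≤ j) (hjk : j ≤ k) :
    Separated u i k ↔ Separated u i j ∨ Separated u j k := by
  constructor
  · rintro ⟨l, h1, h2, h3⟩
    rcases le_or_gt l j with h | h
    · exact .inl ⟨l, h1, h, h3⟩
    · exact .inr ⟨l, h, h2, h3⟩
  · rintro (⟨l, h1, h2, h3⟩ | ⟨l, h1, h2, h3⟩)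
    · exact ⟨l, h1, h2.trans hjk, h3⟩
    · exact ⟨l, by omega, h2, h3⟩

theorem not_separated_self (u : List Bool) (i : ℕ) : ¬ Separated u i i := by
  rintro ⟨k, h1, h2, -⟩
  omega

theorem layeredLt_trans {u : List Bool} {i j k : ℕ} (h1 : LayeredLt u i j)
    (h2 : LayeredLt u j k) : LayeredLt u i k := by
  unfold LayeredLt at *
  rcases h1 with ⟨a1, b1⟩ | ⟨a1, b1⟩ <;> rcases h2 with ⟨a2, b2⟩ | ⟨a2, b2⟩
  · exact .inl ⟨by omega, (separated_iff_or a1.le a2.le).2 (.inl b1)⟩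
  · rcases lt_trichotomy i k with h | rfl | h
    · rw [separated_iff_or h.le a2.le] at b1
      exact .inl ⟨h, b1.resolve_right b2⟩
    · exact absurd b1 b2
    · rw [separated_iff_or h.le a1.le] at b2
      exact absurd (.inr b1) b2
  · rcases lt_trichotomy i k with h | rfl | h
    · rw [separated_iff_or a1.le h.le] at b2
      exact .inl ⟨h, b2.resolve_left b1⟩
    · exact absurd b2 b1
    · rw [separated_iff_or a2.le h.le] at b1
      exact absurd (.inl b2) b1
  · exact .inr ⟨by omega, by rw [separated_iff_or a2.le a1.le]; tauto⟩

theorem layeredLt_irrefl (u : List Bool) (i : ℕ) : ¬ LayeredLt u i i := by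
  rintro (⟨h, -⟩ | ⟨h, -⟩) <;> omega

theorem layeredLt_or_layeredLt {u : List Bool} {i j : ℕ} (h : i ≠ j) :
    LayeredLt u i j ∨ LayeredLt u j i := by
  unfold LayeredLt
  rcases lt_or_gt_of_ne h with h | h <;> tauto

/-- Two positions in the same block of the layered permutation given by `u`. -/
def blockSetoid (u : List Bool) : Setoid ℕ where
  r i j := ¬ Separated u i j ∧ ¬ Separated u j i
  iseqv :=
    { refl := fun i => ⟨not_separated_self u i, not_separated_self u i⟩
      symm := fun h => ⟨h.2, h.1⟩
      trans := by
        have key : ∀ {i j k : ℕ}, ¬ Separated u i j → ¬ Separated u j k → ¬ Separated u i k := by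
          rintro i j k h1 h2 ⟨l, h3, h4, h5⟩
          rcases le_or_gt l j with h | h
          · exact h1 ⟨l, h3, h, h5⟩
          · exact h2 ⟨l, h, h4, h5⟩
        exact fun {_ _ _} h1 h2 => ⟨key h1.1 h2.1, key h2.2 h1.2⟩ }

theorem not_separated_of_ge (u : List Bool) {i j : ℕ} (h : j ≤ i) : ¬ Separated u i j := by
  rintro ⟨k, h1, h2, -⟩
  omega

theorem blockSetoid_iff {u : List Bool} {i j : ℕ} (h : i ≤ j) :
    blockSetoid u i j ↔ ¬ Separated u i j :=
  and_iff_left (not_separated_of_ge u h)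

theorem blockSetoid_interval_lt {u : List Bool} {i j k : ℕ} (h : blockSetoid u i k)
    (h1 : i < j) (h2 : j < k) : blockSetoid u i j := by
  rw [blockSetoid_iff (by omega), separated_iff_or h1.le h2.le] at h
  rw [blockSetoid_iff h1.le]
  tauto

theorem layeredLt_iff_of_block {u : List Bool} {i j : ℕ} (h : blockSetoid u i j) :
    LayeredLt u i j ↔ j < i := by
  have h1 := h.1
  have h2 := h.2
  unfold LayeredLt
  tauto

theorem layeredLt_iff_of_not_block {u : List Bool} {i j : ℕ} (h : ¬ blockSetoid u i j) :
    LayeredLt u i j ↔ i < j := by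
  have h' : ¬ (¬ Separated u i j ∧ ¬ Separated u j i) := h
  have h1 : j ≤ i → ¬ Separated u i j := fun h => not_separated_of_ge u h
  have h2 : i ≤ j → ¬ Separated u j i := fun h => not_separated_of_ge u h
  unfold LayeredLt
  constructor
  · rintro (h3 | h3)
    · exact h3.1
    · exact absurd ⟨h1 h3.1.le, h3.2⟩ h'
  · intro h3
    exact .inl ⟨h3, by have := h2 h3.le; tauto⟩

/-- If `j` lay outside the block of `i` and `k`, both steps would be increasing, giving `i < k`;
inside the block the second order gives `k < i`. -/
theorem blockSetoid_interval_layeredLt {u : List Bool} {i j k : ℕ} (h : blockSetoid u i k)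
    (h1 : LayeredLt u i j) (h2 : LayeredLt u j k) : blockSetoid u i j := by
  by_contra h3
  have h4 : ¬ blockSetoid u j k := fun h4 => h3 ((blockSetoid u).trans h ((blockSetoid u).symm h4))
  have h5 := layeredLt_trans h1 h2
  rw [layeredLt_iff_of_not_block h3] at h1
  rw [layeredLt_iff_of_not_block h4] at h2
  rw [layeredLt_iff_of_block h] at h5
  omega

theorem isLayered_layeredStructure (u : List Bool) {n : ℕ} (σ : Equiv.Perm (Fin n)) :
    @IsLayered (Fin n) (layeredStructure u σ) := by
  let _ := layeredStructure u σ
  have e : ∀ a b : Fin n, Lt₂ a b ↔ LayeredLt u (σ a) (σ b) := layeredStructure_lt₂ u σ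
  have e₁ : ∀ a b : Fin n, Lt₁ a b ↔ σ a < σ b := layeredStructure_lt₁ u σ
  have hne : ∀ {a b : Fin n}, a ≠ b → (σ a : ℕ) ≠ σ b := fun h h' =>
    h (σ.injective (Fin.ext h'))
  refine { finite := inferInstance, lt₁ := ?_, lt₂ := ?_, exists_blocks := ?_ }
  · refine { trichotomous := fun a b h1 h2 => ?_, irrefl := fun a => ?_, trans := fun a b c => ?_ }
    · rw [e₁] at h1 h2
      exact σ.injective (le_antisymm (not_lt.1 h2) (not_lt.1 h1))
    · rw [e₁]; exact lt_irrefl _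
    · simp only [e₁]; exact lt_trans
  · refine { trichotomous := fun a b h1 h2 => ?_, irrefl := fun a => ?_, trans := fun a b c => ?_ }
    · rw [e] at h1 h2
      by_contra h
      exact (layeredLt_or_layeredLt (u := u) (hne h)).elim h1 h2
    · rw [e]; exact layeredLt_irrefl _ _
    · simp only [e]; exact layeredLt_trans
  · refine ⟨(blockSetoid u).comap fun a => (σ a : ℕ), ?_, ?_, ?_, ?_⟩
    · intro a b c h h1 h2
      exact blockSetoid_interval_lt h h1 h2
    · intro a b c h h1 h2
      exact blockSetoid_interval_layeredLt h h1 h2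
    · intro a b h h1
      exact (layeredLt_iff_of_block ((blockSetoid u).symm h)).2 h1
    · intro a b h h1
      exact (layeredLt_iff_of_not_block h).2 h1

/-! ### Every layered permutation comes from a unique labeling and word -/

theorem structure_ext {n : ℕ} {A B : permLang.Structure (Fin n)}
    (h₁ : ∀ a b, @Lt₁ _ A a b ↔ @Lt₁ _ B a b) (h₂ : ∀ a b, @Lt₂ _ A a b ↔ @Lt₂ _ B a b) :
    A = B := by
  refine Structure.ext ?_ ?_
  · funext _ f
    exact Empty.elim f
  · funext _ R x
    cases R with
    | lt₁ =>
      exact propext ((@relMap_lt₁ _ A x).trans ((h₁ _ _).trans (@relMap_lt₁ _ B x).symm))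
    | lt₂ =>
      exact propext ((@relMap_lt₂ _ A x).trans ((h₂ _ _).trans (@relMap_lt₂ _ B x).symm))

theorem exists_equiv_fin_of_isStrictTotalOrder {α : Type*} [Fintype α] {n : ℕ}
    (hn : Fintype.card α = n) (r : α → α → Prop) [IsStrictTotalOrder α r] :
    ∃ e : α ≃ Fin n, ∀ a b, r a b ↔ e a < e b := by
  classical
  let _ := linearOrderOfSTO r
  exact ⟨(Fintype.orderIsoFinOfCardEq α hn).symm.toEquiv, fun a b =>
    ((Fintype.orderIsoFinOfCardEq α hn).symm.lt_iff_lt (x := a) (y := b)).symm⟩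

/-- The word whose later letters are given by `c`; the first point always starts a block. -/
def cutWord {m : ℕ} (c : Fin m → Bool) : List Bool := true :: List.ofFn c

theorem cutWord_getElem?_succ {m : ℕ} (c : Fin m → Bool) (k : Fin m) :
    (cutWord c)[(k : ℕ) + 1]? = some (c k) := by
  simp [cutWord]

theorem separated_cutWord_iff {m : ℕ} (c : Fin m → Bool) (i j : ℕ) :
    Separated (cutWord c) i j ↔ ∃ k : Fin m, i ≤ k ∧ (k : ℕ) < j ∧ c k = true := by
  constructor
  · rintro ⟨k, h1, h2, h3⟩
    obtain ⟨hk, -⟩ := List.getElem?_eq_some_iff.1 h3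
    obtain ⟨k, rfl⟩ := Nat.exists_eq_add_one_of_ne_zero (n := k) (by omega)
    have hk' : k < m := by simpa [cutWord] using hk
    have := cutWord_getElem?_succ c ⟨k, hk'⟩
    exact ⟨⟨k, hk'⟩, by simp; omega, by simp; omega, by simpa [h3] using this.symm⟩
  · rintro ⟨k, h1, h2, h3⟩
    exact ⟨k + 1, by omega, by omega, by rw [cutWord_getElem?_succ, h3]⟩

theorem layeredLt_cutWord_succ {m : ℕ} (c : Fin m → Bool) (k : Fin m) :
    LayeredLt (cutWord c) k (k + 1) ↔ c k = true := by
  unfold LayeredLt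
  simp only [separated_cutWord_iff]
  constructor
  · rintro (⟨-, l, h1, h2, h3⟩ | ⟨h, -⟩)
    · rwa [show k = l from Fin.ext (by omega)]
    · omega
  · exact fun h => .inl ⟨by omega, k, le_rfl, by omega, h⟩

/-- The layered permutation on `Fin (m + 1)` with labeling `σ` and cuts `c`. -/
@[reducible] def layeredOf {m : ℕ} (x : Equiv.Perm (Fin (m + 1)) × (Fin m → Bool)) :
    permLang.Structure (Fin (m + 1)) :=
  layeredStructure (cutWord x.2) x.1

/-- The labeling is recovered from `<₁`, since `Fin (m + 1)` has no nontrivial order automorphism,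
and the letters from `<₂` on consecutive points. -/
theorem layeredOf_injective (m : ℕ) : Function.Injective (layeredOf (m := m)) := by
  rintro ⟨σ, c⟩ ⟨τ, d⟩ h
  have h₁ : ∀ a b, σ a < σ b ↔ τ a < τ b := fun a b => by
    have := layeredStructure_lt₁ (cutWord c) σ a b
    rw [← layeredStructure_lt₁ (cutWord d) τ a b, ← this]
    exact iff_of_eq (congrArg (fun S => @Lt₁ _ S a b) h)
  have h₂ : ∀ a b, LayeredLt (cutWord c) (σ a) (σ b) ↔ LayeredLt (cutWord d) (τ a) (τ b) :=
    fun a b => by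
      have := layeredStructure_lt₂ (cutWord c) σ a b
      rw [← layeredStructure_lt₂ (cutWord d) τ a b, ← this]
      exact iff_of_eq (congrArg (fun S => @Lt₂ _ S a b) h)
  let e : Fin (m + 1) ≃o Fin (m + 1) :=
    { toEquiv := σ.symm.trans τ
      map_rel_iff' := fun {a b} => by
        have := h₁ (σ.symm b) (σ.symm a)
        simp only [Equiv.apply_symm_apply] at this
        simp only [Equiv.trans_apply]
        rw [← not_lt, ← not_lt, this] }
  have he : ∀ a, τ (σ.symm a) = a := fun a => by
    have : e = OrderIso.refl _ := Subsingleton.elim _ _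
    exact congrArg (fun f : Fin (m + 1) ≃o Fin (m + 1) => f a) this
  obtain rfl : σ = τ := Equiv.ext fun a => by simpa using (he (σ a)).symm
  refine Prod.ext rfl (funext fun k => Bool.eq_iff_iff.2 ?_)
  rw [← layeredLt_cutWord_succ, ← layeredLt_cutWord_succ]
  simpa using h₂ (σ.symm k.castSucc) (σ.symm k.succ)

theorem exists_layeredOf_eq {m : ℕ} (S : permLang.Structure (Fin (m + 1)))
    (hS : @IsLayered _ S) : ∃ x, layeredOf x = S := by
  classical
  let _ := S
  obtain ⟨r, hr₁, -, hin, hout⟩ := hS.exists_blocks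
  have hlt₁ := hS.lt₁
  have hlt₂ := hS.lt₂
  obtain ⟨σ, hσ⟩ := exists_equiv_fin_of_isStrictTotalOrder (Fintype.card_fin (m + 1))
    (Lt₁ : Fin (m + 1) → Fin (m + 1) → Prop)
  -- Points consecutive in `<₁` lie in different blocks exactly when `<₂` agrees with `<₁` on them.
  let c : Fin m → Bool := fun k => decide (Lt₂ (σ.symm k.castSucc) (σ.symm k.succ))
  have hasymm : ∀ a b : Fin (m + 1), Lt₂ a b → ¬ Lt₂ b a := fun a b => asymm
  have hlt : ∀ i j : Fin (m + 1), Lt₁ (σ.symm i) (σ.symm j) ↔ i < j := by simp [hσ]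
  have hin' : ∀ i j : Fin (m + 1), i < j → (Lt₂ (σ.symm i) (σ.symm j) ↔
      ¬ r (σ.symm i) (σ.symm j)) := fun i j h =>
    ⟨fun h1 h2 => hasymm _ _ h1 (hin _ _ h2 ((hlt _ _).2 h)), fun h1 => hout _ _ h1 ((hlt _ _).2 h)⟩
  have hmono : ∀ i i' j' j : Fin (m + 1), i ≤ i' → i' ≤ j' → j' ≤ j →
      r (σ.symm i) (σ.symm j) → r (σ.symm i') (σ.symm j') := by
    have key : ∀ i k j : Fin (m + 1), i ≤ k → k ≤ j → r (σ.symm i) (σ.symm j) →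
        r (σ.symm i) (σ.symm k) := by
      intro i k j h1 h2 h
      rcases h1.eq_or_lt with rfl | h1
      · exact r.refl _
      rcases h2.eq_or_lt with rfl | h2
      · exact h
      exact hr₁ _ _ _ h ((hlt _ _).2 h1) ((hlt _ _).2 h2)
    intro i i' j' j h1 h2 h3 h
    exact r.trans (r.symm (key i i' j h1 (h2.trans h3) h)) (key i j' j (h1.trans h2) h3 h)
  have hsep : ∀ i j : Fin (m + 1), i ≤ j → (Separated (cutWord c) i j ↔
      ¬ r (σ.symm i) (σ.symm j)) := by
    intro i j hij
    rw [separated_cutWord_iff]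
    constructor
    · rintro ⟨k, h1, h2, h3⟩ h
      have h4 := (hin' k.castSucc k.succ Fin.castSucc_lt_succ).1 (of_decide_eq_true h3)
      exact h4 (hmono _ _ _ _ (Fin.le_def.2 (by simpa using h1)) Fin.castSucc_lt_succ.le
        (Fin.le_def.2 (by simpa using h2)) h)
    · intro h
      by_contra! hc
      refine h ?_
      -- With no cut between `i` and `j`, consecutive points are equivalent, and transitivity
      -- carries this from `i` to `j`.
      have step : ∀ d : ℕ, ∀ hd : (i : ℕ) + d < m + 1, i + d ≤ (j : ℕ) →
          r (σ.symm i) (σ.symm ⟨i + d, hd⟩) := by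
        intro d
        induction d with
        | zero => intro _ _; exact r.refl _
        | succ d ih =>
          intro hd hdj
          refine r.trans (ih (by omega) (by omega)) ?_
          have h1 := hc ⟨i + d, by omega⟩ (by simp) (by simp; omega)
          have h2 := of_decide_eq_false (Bool.eq_false_iff.2 h1)
          by_contra h3
          exact h2 ((hin' _ _ Fin.castSucc_lt_succ).2 h3)
      have := step (j - i) (by omega) (by omega)
      convert this using 2
      exact Fin.ext (by simp; omega)
  refine ⟨(σ, c), structure_ext (fun a b => ?_) fun a b => ?_⟩
  · exact (layeredStructure_lt₁ (cutWord c) σ a b).trans (hσ a b).symm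
  · refine (layeredStructure_lt₂ (cutWord c) σ a b).trans ?_
    rcases lt_trichotomy (σ a) (σ b) with h | h | h
    · have h1 := hsep _ _ h.le
      have h2 := hin' _ _ h
      simp only [Equiv.symm_apply_apply] at h1 h2
      have h' : (σ a : ℕ) < σ b := h
      rw [h2, ← h1]
      unfold LayeredLt
      constructor
      · rintro (h3 | h3)
        · exact h3.2
        · omega
      · exact fun h3 => .inl ⟨h', h3⟩
    · obtain rfl := σ.injective h
      exact iff_of_false (layeredLt_irrefl _ _) (irrefl a)
    · have h1 := hsep _ _ h.le
      have h2 := hin' _ _ h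
      simp only [Equiv.symm_apply_apply] at h1 h2
      have h' : (σ b : ℕ) < σ a := h
      have hab : Lt₂ a b ↔ ¬ Lt₂ b a :=
        ⟨hasymm a b, fun h3 => by
          by_contra h4
          exact h.ne (congrArg σ (hlt₂.trichotomous _ _ h3 h4))⟩
      rw [hab, h2, ← h1]
      unfold LayeredLt
      constructor
      · rintro (h3 | h3)
        · omega
        · exact h3.2
      · exact fun h3 => .inr ⟨h', h3⟩

/-- Relabeling is an isomorphism of layered permutations. -/
def layeredOfEquiv {m : ℕ} (σ : Equiv.Perm (Fin (m + 1))) (c : Fin m → Bool) :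
    letI A : permLang.Structure (Fin (m + 1)) := layeredOf (σ, c)
    letI B : permLang.Structure (Fin (m + 1)) := layeredOf (1, c)
    @FirstOrder.Language.Equiv permLang (Fin (m + 1)) (Fin (m + 1)) A B :=
  letI A : permLang.Structure (Fin (m + 1)) := layeredOf (σ, c)
  letI B : permLang.Structure (Fin (m + 1)) := layeredOf (1, c)
  @FirstOrder.Language.Equiv.mk permLang (Fin (m + 1)) (Fin (m + 1)) A B σ
    (fun f => Empty.elim f)
    (fun R x => by cases R <;> rfl)

theorem eq_layeredOf_of_equiv {m : ℕ} {S : permLang.Structure (Fin (m + 1))} {c : Fin m → Bool}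
    (e : @FirstOrder.Language.Equiv permLang (Fin (m + 1)) (Fin (m + 1)) S (layeredOf (1, c))) :
    ∃ σ, S = layeredOf (σ, c) := by
  let σ := @FirstOrder.Language.Equiv.toEquiv permLang _ _ S (layeredOf (1, c)) e
  have he := @FirstOrder.Language.Equiv.map_rel' permLang _ _ S (layeredOf (1, c)) e 2
  refine ⟨σ, structure_ext (fun a b => ?_) fun a b => ?_⟩
  · exact (he PermRel.lt₁ ![a, b]).symm.trans (layeredStructure_lt₁ (cutWord c) σ a b)
  · exact (he PermRel.lt₂ ![a, b]).symm.trans (layeredStructure_lt₂ (cutWord c) σ a b)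

theorem layeredOf_realize_iff (φ : permLang.Sentence) {m : ℕ} (σ : Equiv.Perm (Fin (m + 1)))
    (c : Fin m → Bool) :
    @Sentence.Realize permLang _ (layeredOf (σ, c)) φ ↔ WordRealize φ (cutWord c) := by
  have h1 : @Sentence.Realize permLang _ (layeredOf (σ, c)) φ ↔
      @Sentence.Realize permLang _ (layeredOf (1, c)) φ := by
    let A : permLang.Structure (Fin (m + 1)) := layeredOf (σ, c)
    exact @StrongHomClass.realize_sentence permLang _ _ A (layeredOf (1, c)) _ _ _
      (layeredOfEquiv σ c) φ
  have h2 : ∀ (u : List Bool) (n : ℕ), u.length = n →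
      (@Sentence.Realize permLang (Fin n) (layeredStructure u 1) φ ↔ WordRealize φ u) := by
    rintro u _ rfl
    rfl
  exact h1.trans (h2 _ _ (by simp [cutWord]))

/-! ### Counting and the limit laws -/

theorem structuresOn_inter_modelsOn (φ : permLang.Sentence) (m : ℕ) :
    structuresOn layeredPermutations (m + 1) ∩ modelsOn φ (m + 1) =
      layeredOf '' (Set.univ ×ˢ {c : Fin m → Bool | WordRealize φ (cutWord c)}) := by
  ext S
  constructor
  · rintro ⟨h1, h2⟩
    obtain ⟨⟨σ, c⟩, rfl⟩ := exists_layeredOf_eq S h1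
    exact ⟨(σ, c), ⟨trivial, (layeredOf_realize_iff φ σ c).1 h2⟩, rfl⟩
  · rintro ⟨⟨σ, c⟩, ⟨-, h⟩, rfl⟩
    exact ⟨isLayered_layeredStructure _ _, (layeredOf_realize_iff φ σ c).2 h⟩

/-- This makes the total counts the case `φ = ⊤` of the counts of models. -/
theorem structuresOn_eq_inter (m : ℕ) : structuresOn layeredPermutations m =
    structuresOn layeredPermutations m ∩ modelsOn ⊤ m := by
  refine (Set.inter_eq_left.2 fun S _ => ?_).symm
  exact @BoundedFormula.realize_top permLang _ S _ _ _ _ |>.2 trivial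

theorem wordRealize_top (u : List Bool) : WordRealize ⊤ u ↔ True :=
  @BoundedFormula.realize_top permLang _ (layeredStructure u 1) _ _ _ _

theorem labeledCount_inter (φ : permLang.Sentence) (m : ℕ) :
    labeledCount (structuresOn layeredPermutations (m + 1) ∩ modelsOn φ (m + 1)) =
      (m + 1).factorial * wordCount (fun l => WordRealize φ ([true] ++ l)) m := by
  rw [structuresOn_inter_modelsOn, labeledCount,
    Set.ncard_image_of_injective _ (layeredOf_injective m), Set.ncard_prod, Set.ncard_univ,
    Nat.card_perm, Nat.card_fin]
  rfl

/-- Relabeling is an isomorphism, so a type depends only on the word. Conversely an isomorphism is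
itself a relabeling, so `layeredOf_injective` separates the types of distinct words. -/
theorem unlabeledCount_inter (φ : permLang.Sentence) (m : ℕ) :
    unlabeledCount (structuresOn layeredPermutations (m + 1) ∩ modelsOn φ (m + 1)) =
      wordCount (fun l => WordRealize φ ([true] ++ l)) m := by
  have hmk : ∀ (σ : Equiv.Perm (Fin (m + 1))) (c : Fin m → Bool),
      Quotient.mk (isoSetoid permLang (m + 1)) (layeredOf (σ, c)) =
        Quotient.mk (isoSetoid permLang (m + 1)) (layeredOf (1, c)) := fun σ c =>
    Quotient.sound ⟨layeredOfEquiv σ c⟩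
  have hinj : Function.Injective fun c : Fin m → Bool =>
      Quotient.mk (isoSetoid permLang (m + 1)) (layeredOf (1, c)) := by
    intro c d h
    obtain ⟨e⟩ := Quotient.exact h
    obtain ⟨σ, hσ⟩ := eq_layeredOf_of_equiv e
    exact (Prod.ext_iff.1 (layeredOf_injective m hσ)).2
  have himg : Quotient.mk (isoSetoid permLang (m + 1)) ''
      (layeredOf '' (Set.univ ×ˢ {c : Fin m → Bool | WordRealize φ (cutWord c)})) =
      (fun c : Fin m → Bool => Quotient.mk (isoSetoid permLang (m + 1)) (layeredOf (1, c))) ''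
        {c : Fin m → Bool | WordRealize φ (cutWord c)} := by
    ext q
    constructor
    · rintro ⟨_, ⟨⟨σ, c⟩, ⟨-, h⟩, rfl⟩, rfl⟩
      exact ⟨c, h, (hmk σ c).symm⟩
    · rintro ⟨c, h, rfl⟩
      exact ⟨_, ⟨(1, c), ⟨trivial, h⟩, rfl⟩, rfl⟩
  rw [structuresOn_inter_modelsOn, unlabeledCount, himg, Set.ncard_image_of_injective _ hinj]
  rfl

theorem labeledCount_layered (m : ℕ) :
    labeledCount (structuresOn layeredPermutations (m + 1)) = (m + 1).factorial * 2 ^ m := by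
  rw [structuresOn_eq_inter, labeledCount_inter]
  simp only [wordRealize_top, wordCount_true]

theorem unlabeledCount_layered (m : ℕ) :
    unlabeledCount (structuresOn layeredPermutations (m + 1)) = 2 ^ m := by
  rw [structuresOn_eq_inter, unlabeledCount_inter]
  simp only [wordRealize_top, wordCount_true]

theorem eventually_atTop_of_succ {p : ℕ → Prop} (h : ∀ m, p (m + 1)) : ∀ᶠ n in atTop, p n := by
  filter_upwards [eventually_ge_atTop 1] with n hn
  obtain ⟨m, rfl⟩ := Nat.exists_eq_add_of_le' hn
  exact h m

theorem labeledLimitLaw_layeredPermutations : LabeledLimitLaw layeredPermutations := by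
  refine ⟨eventually_atTop_of_succ fun m => ?_, fun φ => ?_⟩
  · rw [labeledCount_layered]
    positivity
  · obtain ⟨p, hp⟩ := exists_tendsto_wordRealize φ [true]
    refine ⟨p, (tendsto_add_atTop_iff_nat 1).1 (hp.congr fun m => ?_)⟩
    rw [labeledCount_inter, labeledCount_layered]
    have : ((m + 1).factorial : ℝ) ≠ 0 := by positivity
    push_cast
    rw [mul_div_mul_left _ _ this]

theorem unlabeledLimitLaw_layeredPermutations : UnlabeledLimitLaw layeredPermutations := by
  refine ⟨eventually_atTop_of_succ fun m => ?_, fun φ => ?_⟩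
  · rw [unlabeledCount_layered]
    positivity
  · obtain ⟨p, hp⟩ := exists_tendsto_wordRealize φ [true]
    refine ⟨p, (tendsto_add_atTop_iff_nat 1).1 (hp.congr fun m => ?_)⟩
    rw [unlabeledCount_inter, unlabeledCount_layered]
    push_cast
    rfl

end LimitLaw

theorem theorem4 :
    LimitLaw.LabeledLimitLaw LimitLaw.layeredPermutations ∧
      LimitLaw.UnlabeledLimitLaw LimitLaw.layeredPermutations :=
  ⟨LimitLaw.labeledLimitLaw_layeredPermutations, LimitLaw.unlabeledLimitLaw_layeredPermutations⟩
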